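/- Conventions. A groupoid is a set $G$ with a set $G^{(2)}\subset G\times G$ of composable pairs, an associative product $G^{(2)}\to G$, $(x,y)\mapsto xy$, and an inverse map $x\mapsto x^{-1}$ satisfying the usual groupoid axioms. Put $r(x)=xx^{-1}$, $d(x)=x^{-1}x$, $G^{(0)}=r(G)=d(G)$, $G^u=r^{-1}(\{u\})$ and $G_u=d^{-1}(\{u\})$ for $u\in G^{(0)}$. For $A,B\subset G$ put $AB=\{xy:(x,y)\in G^{(2)}\cap(A\times B)\}$ and $A^{-1}=\{x: x^{-1}\in A\}$. $G$ is transitive if for all $u,v\in G^{(0)}$ there is $x\in G$ with $r(x)=u$ and $d(x)=v$. A topology on $G$ makes $G$ a topological groupoid if the inverse map and the product map ($G^{(2)}$ carrying the topology induced from $G\times G$) are continuous. A topological groupoid is locally transitive if for every $u\in G^{(0)}$ the map $G_u\to G^{(0)}$, $x\mapsto r(x)$, is open ($G_u$ and $G^{(0)}$ carrying the topologies induced from $G$). A $G$-uniformity is a non-empty collection $\mathcal W$ of subsets of $G$ such that: (a) $G^{(0)}\subset W$ and $W=W^{-1}$ for all $W\in\mathcal W$; (b) for all $W_1,W_2\in\mathcal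 W$ there is $W_3\in\mathcal W$ with $W_3\subset W_1\cap W_2$; (c) for every $W_1\in\mathcal W$ there is $W_2\in\mathcal W$ with $W_2W_2\subset W_1$. Its associated topology $\tau_{\mathcal W}$ is the one in which $A\subset G$ is open if and only if for every $x\in A$ there is $W\in\mathcal W$ with $WxW\subset A$. If $G$ carries a topology $\tau$, then $\mathcal W$ is compatible with the topology of the $r$-fibres if for every $u\in G^{(0)}$ and every open neighbourhood $U$ of $u$ there is $W\in\mathcal W$ such that $W\cap G^u\subset U\cap G^u$ and $u$ is in the interior of $W\cap G^u$ relative to $G^u$. Theorem. Let $G$ be a transitive groupoid endowed with a second countable, locally compact Hausdorff topology $\tau$ making $G$ a topological groupoid. Then there are a countable $G$-uniformity $\mathcal W$, compatible with the topology of the $r$-fibres of $(G,\tau)$, and a topology $\tilde\tau=\tau_{\mathcal W}$ on $G$ such that: 1. $G$ is a locally transitive topological groupoid with respect to $\tilde\tau$, and its range map $r:G\to G^{(0)}$ is open with respect to $\tilde\tau$ (on $G^{(0)}$, the topology induced by $\tilde\tau$). 2. $\tilde\tau$ is finer than $\tau$ (not necessarily strictly), and $\tilde\tau=\tau$ if $(G,\tau)$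 is locally transitive. 3. For every $u\in G^{(0)}$, $\tau$ and $\tilde\tau$ induce the same topology on $G^u$ and the same topology on $G_u$. 4. $\tilde\tau$ is second countable and locally compact Hausdorff. 5. $\tau$ and $\tilde\tau$ generate the same Borel $\sigma$-algebra on $G$. -/

import Mathlib

/-- An algebraic groupoid in the single-set presentation: a set `G` with a set of composable pairs,
a product defined on composable pairs, and an inverse map. The product is represented by a function
`mul` on all pairs; its values on non-composable pairs are unconstrained and are never used. -/
class AlgGroupoid (G : Type*) where
  /-- `Comp x y` means that `(x, y)` is a composable pair. -/
  Comp : G → G → Prop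
  mul : G → G → G
  inv : G → G
  inv_inv : ∀ x, inv (inv x) = x
  assoc : ∀ x y z, Comp x y → Comp y z →
    Comp (mul x y) z ∧ Comp x (mul y z) ∧ mul (mul x y) z = mul x (mul y z)
  inv_comp : ∀ x, Comp (inv x) x
  inv_mul_mul : ∀ x y, Comp x y → mul (inv x) (mul x y) = y
  comp_inv : ∀ x, Comp x (inv x)
  mul_mul_inv : ∀ z x, Comp z x → mul (mul z x) (inv x) = z

namespace AlgGroupoid

section Algebra

variable {G : Type*} [AlgGroupoid G]

/-- The range `r(x) = x x⁻¹`. -/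
def r (x : G) : G := mul x (inv x)

/-- The domain (source) `d(x) = x⁻¹ x`. -/
def d (x : G) : G := mul (inv x) x

variable (G) in
/-- The unit space `G⁽⁰⁾`, the set of all ranges of elements. -/
def units : Set G := Set.range (r : G → G)

/-- The range map `G → G⁽⁰⁾`. -/
def rangeMap (x : G) : units G := ⟨r x, x, rfl⟩

/-- The fibre `G^u` of the range map. -/
def rFibre (u : G) : Set G := {x | r x = u}

/-- The fibre `G_u` of the domain map. -/
def dFibre (u : G) : Set G := {x | d x = u}

/-- The product `AB` of subsets of a groupoid. -/
def setMul (A B : Set G) : Set G := {z | ∃ x ∈ A, ∃ y ∈ B, Comp x y ∧ z = mul x y}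

/-- The set `A⁻¹`. -/
def setInv (A : Set G) : Set G := {x | inv x ∈ A}

variable (G) in
/-- A transitive groupoid. -/
def IsTransitive : Prop :=
  ∀ u ∈ units G, ∀ v ∈ units G, ∃ x : G, r x = u ∧ d x = v

end Algebra

/-- A topological groupoid: inversion is continuous, and so is the product on the set of composable
pairs with the topology induced from `G × G`. -/
structure IsTopologicalGroupoid (G : Type*) [AlgGroupoid G] [TopologicalSpace G] : Prop where
  continuous_inv : Continuous (inv : G → G)
  continuousOn_mul : ContinuousOn (fun p : G × G => mul p.1 p.2) {p : G × G | Comp p.1 p.2}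

/-- Local transitivity: for every unit `u` the restriction `G_u → G⁽⁰⁾` of the range map is open,
where both sets carry the topology induced from `G`. -/
def IsLocallyTransitive (G : Type*) [AlgGroupoid G] [TopologicalSpace G] : Prop :=
  ∀ u ∈ units G, IsOpenMap (fun x : dFibre u => rangeMap (x : G))

/-- A `G`-uniformity: a (non-empty) collection of subsets of `G` containing the unit space, directed
downwards, closed under "square roots", and consisting of symmetric sets. -/
structure GUniformity (G : Type*) [AlgGroupoid G] where
  sets : Set (Set G)
  nonempty : sets.Nonempty
  units_subset : ∀ W ∈ sets, units G ⊆ W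
  exists_subset_inter : ∀ W₁ ∈ sets, ∀ W₂ ∈ sets, ∃ W₃ ∈ sets, W₃ ⊆ W₁ ∩ W₂
  exists_setMul_subset : ∀ W₁ ∈ sets, ∃ W₂ ∈ sets, setMul W₂ W₂ ⊆ W₁
  symm : ∀ W ∈ sets, W = setInv W

namespace GUniformity

variable {G : Type*} [AlgGroupoid G]

/-- The topology associated with a `G`-uniformity `𝒲`: a set `A` is open if and only if for every
`x ∈ A` there is `W ∈ 𝒲` with `W x W ⊆ A`. -/
@[reducible] def topology (𝒲 : GUniformity G) : TopologicalSpace G where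
  IsOpen A := ∀ x ∈ A, ∃ W ∈ 𝒲.sets, setMul (setMul W {x}) W ⊆ A
  isOpen_univ := fun _ _ => ⟨_, 𝒲.nonempty.some_mem, Set.subset_univ _⟩
  isOpen_inter := by
    rintro A B hA hB x ⟨hxA, hxB⟩
    obtain ⟨W₁, h₁, hW₁⟩ := hA x hxA
    obtain ⟨W₂, h₂, hW₂⟩ := hB x hxB
    obtain ⟨W₃, h₃, hW₃⟩ := 𝒲.exists_subset_inter W₁ h₁ W₂ h₂
    refine ⟨W₃, h₃, ?_⟩
    rintro z ⟨y, ⟨a, ha, b, hb, hab, hy⟩, c, hc, hyc, hz⟩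
    exact ⟨hW₁ ⟨y, ⟨a, (hW₃ ha).1, b, hb, hab, hy⟩, c, (hW₃ hc).1, hyc, hz⟩,
      hW₂ ⟨y, ⟨a, (hW₃ ha).2, b, hb, hab, hy⟩, c, (hW₃ hc).2, hyc, hz⟩⟩
  isOpen_sUnion := by
    rintro S hS x ⟨A, hAS, hxA⟩
    obtain ⟨W, hW, h⟩ := hS A hAS x hxA
    exact ⟨W, hW, h.trans (Set.subset_sUnion_of_mem hAS)⟩

/-- Compatibility of a `G`-uniformity with the topology of the `r`-fibres: for every unit `u` and
every open neighbourhood `U` of `u` there is `W ∈ 𝒲` such that `W ∩ G^u ⊆ U ∩ G^u` and `u` is in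
the interior of `W ∩ G^u` relative to `G^u`. -/
def CompatibleWithRFibres [TopologicalSpace G] (𝒲 : GUniformity G) : Prop :=
  ∀ u ∈ units G, ∀ U : Set G, IsOpen U → u ∈ U →
    ∃ W ∈ 𝒲.sets, W ∩ rFibre u ⊆ U ∩ rFibre u ∧
      ∃ O : Set G, IsOpen O ∧ u ∈ O ∧ O ∩ rFibre u ⊆ W ∩ rFibre u

end GUniformity

end AlgGroupoid

/-! In a locally transitive topological groupoid the elements near `x` are the products `a x b` with
`a` near `r(x)` in `G_{r(x)}` and `b` near `d(x)` in `G^{d(x)}`. The new topology takes this as its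
definition, and so depends only on the fibre topologies of `τ`. This is `nhds_eq_map`, valid as soon
as the traces of `𝒲` on each `G^u` form a `τ`-neighbourhood basis of `u` (`IsFibreBasis`). The
comparison with `τ` then follows from continuity of products and translations, and continuity of the
new product from continuity of conjugation on isotropy.

By transitivity, `(a, b) ↦ a b⁻¹` is an open continuous surjection from `G_e × G_e` with `τ` onto
`G` with the new topology (`isOpenQuotientMap_mul_inv`), so local compactness and second
countability descend. New open sets are then σ-compact, hence `F_σ` for `τ`, which gives equality of
Borel sets.

For `𝒲`, take countably many compactly supported functions separating points from complements of
neighbourhoods, and let the `n`-th set consist of the elements whose left translation moves the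
first `n` functions by at most `2⁻ⁿ`. Compact support makes its traces neighbourhoods; separation
makes them small (`isFibreBasis_uniformityOfSeq`). -/

open Filter Topology Set

namespace AlgGroupoid

/-! ### Groupoid identities. -/

section Algebra

variable {G : Type*} [AlgGroupoid G]

theorem d_inv (x : G) : d (inv x) = r x := by
  simp only [d, r, inv_inv]

theorem r_inv (x : G) : r (inv x) = d x := by
  simp only [d, r, inv_inv]

theorem Comp.d_eq_r {x y : G} (h : Comp x y) : d x = r y := by
  obtain ⟨h₁, -, h₃⟩ := assoc (inv x) x y (inv_comp x) h
  rw [inv_mul_mul x y h] at h₃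
  have h₄ := mul_mul_inv (mul (inv x) x) y h₁
  rw [h₃] at h₄
  exact h₄.symm

theorem r_mul_self (x : G) : mul (r x) x = x := by
  have h := mul_mul_inv x (inv x) (comp_inv x)
  rwa [inv_inv] at h

theorem comp_r_self (x : G) : Comp (r x) x :=
  (assoc x (inv x) x (comp_inv x) (inv_comp x)).1

theorem comp_d_self (x : G) : Comp x (d x) :=
  (assoc x (inv x) x (comp_inv x) (inv_comp x)).2.1

theorem mul_d_self (x : G) : mul x (d x) = x :=
  (assoc x (inv x) x (comp_inv x) (inv_comp x)).2.2.symm.trans (r_mul_self x)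

/-- For the converse, `x r(y)` and `r(y) y` are composable, so associativity makes `(x r(y)) y`
composable, and `x r(y) = x`. -/
theorem comp_iff {x y : G} : Comp x y ↔ d x = r y := by
  refine ⟨Comp.d_eq_r, fun h => ?_⟩
  have h₁ : Comp x (r y) := h ▸ comp_d_self x
  have h₂ := (assoc x (r y) y h₁ (comp_r_self y)).1
  rwa [← h, mul_d_self] at h₂

theorem d_r (x : G) : d (r x) = r x := (comp_r_self x).d_eq_r

theorem r_d (x : G) : r (d x) = d x := (comp_d_self x).d_eq_r.symm

theorem r_r (x : G) : r (r x) = r x := by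
  rw [← d_inv x, r_d]

theorem r_mul {x y : G} (h : d x = r y) : r (mul x y) = r x := by
  have h₁ := (assoc (r x) x y (comp_r_self x) (comp_iff.2 h)).2.1.d_eq_r
  rw [← h₁, d_r]

theorem d_mul {x y : G} (h : d x = r y) : d (mul x y) = d y := by
  have h₁ := (assoc x y (d y) (comp_iff.2 h) (comp_d_self y)).1.d_eq_r
  rw [h₁, r_d]

theorem mul_assoc' {x y z : G} (h₁ : d x = r y) (h₂ : d y = r z) :
    mul (mul x y) z = mul x (mul y z) :=
  (assoc x y z (comp_iff.2 h₁) (comp_iff.2 h₂)).2.2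

theorem inv_mul_cancel_left' {x y : G} (h : d x = r y) : mul (inv x) (mul x y) = y :=
  inv_mul_mul x y (comp_iff.2 h)

theorem mul_inv_cancel_left' {x y : G} (h : r x = r y) : mul x (mul (inv x) y) = y := by
  have h₁ := inv_mul_cancel_left' (x := inv x) (y := y) (by rw [d_inv, h])
  rwa [inv_inv] at h₁

theorem mul_inv_cancel_right' {x y : G} (h : d x = r y) : mul (mul x y) (inv y) = x :=
  mul_mul_inv x y (comp_iff.2 h)

theorem inv_mul_cancel_right' {x y : G} (h : d x = d y) : mul (mul x (inv y)) y = x := by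
  have h₁ := mul_inv_cancel_right' (x := x) (y := inv y) (by rw [r_inv, h])
  rwa [inv_inv] at h₁

theorem mul_inv_rev' {x y : G} (h : d x = r y) : inv (mul x y) = mul (inv y) (inv x) := by
  have hd : d (inv y) = r (inv x) := by rw [d_inv, r_inv, h]
  have h₁ : mul (mul x y) (mul (inv y) (inv x)) = r (mul x y) := by
    rw [← mul_assoc' (by rw [d_mul h, r_inv]) hd, mul_inv_cancel_right' h, r_mul h, r]
  have h₂ := inv_mul_cancel_left' (x := mul x y) (y := mul (inv y) (inv x))
    (by rw [d_mul h, r_mul hd, r_inv])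
  rw [h₁, ← d_inv (mul x y), mul_d_self] at h₂
  exact h₂

theorem r_mem_units (x : G) : r x ∈ units G := ⟨x, rfl⟩

theorem d_mem_units (x : G) : d x ∈ units G := ⟨inv x, r_inv x⟩

theorem r_of_mem_units {u : G} (hu : u ∈ units G) : r u = u := by
  obtain ⟨x, rfl⟩ := hu
  exact r_r x

theorem d_of_mem_units {u : G} (hu : u ∈ units G) : d u = u := by
  obtain ⟨x, rfl⟩ := hu
  exact d_r x

theorem inv_of_mem_units {u : G} (hu : u ∈ units G) : inv u = u := by
  have h := mul_d_self (inv u)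
  rw [d_inv, r_of_mem_units hu] at h
  rw [← h]
  exact d_of_mem_units hu

/-- The conditions on `a` and `b` are independent, so `AxB` is the image of a full product `(A ∩
G_{r(x)}) × (B ∩ G^{d(x)})`. -/
theorem mem_conj_iff {A B : Set G} {x z : G} : z ∈ setMul (setMul A {x}) B ↔
    ∃ a ∈ A, ∃ b ∈ B, d a = r x ∧ d x = r b ∧ z = mul (mul a x) b := by
  constructor
  · rintro ⟨y, ⟨a, ha, x, rfl, hax, rfl⟩, b, hb, hxb, rfl⟩
    refine ⟨a, ha, b, hb, hax.d_eq_r, ?_, rfl⟩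
    rw [← d_mul hax.d_eq_r, hxb.d_eq_r]
  · rintro ⟨a, ha, b, hb, hax, hxb, rfl⟩
    exact ⟨mul a x, ⟨a, ha, x, rfl, comp_iff.2 hax, rfl⟩, b, hb,
      comp_iff.2 (by rw [d_mul hax, hxb]), rfl⟩

end Algebra

/-! ### Neighbourhoods in the topology of a `G`-uniformity. -/

namespace GUniformity

variable {G : Type*} [AlgGroupoid G] (𝒲 : GUniformity G)

theorem inv_mem_iff {W : Set G} (hW : W ∈ 𝒲.sets) {x : G} : inv x ∈ W ↔ x ∈ W := by
  conv_rhs => rw [𝒲.symm W hW]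
  rfl

/-- The neighbourhood filter of a point in the topology of a `G`-uniformity. -/
def nhds (x : G) : Filter G := @_root_.nhds G 𝒲.topology x

/-- The sets `WxW` need not be open. The points `y` with `VyV ⊆ A` for some `V` do form an open set:
if `V'V' ⊆ V`, then `V'(V'yV')V' ⊆ VyV`. -/
theorem hasBasis_nhds (x : G) :
    (𝒲.nhds x).HasBasis (· ∈ 𝒲.sets) (fun W => setMul (setMul W {x}) W) := by
  refine ⟨fun A => ?_⟩
  rw [nhds, @mem_nhds_iff G 𝒲.topology]
  constructor
  · rintro ⟨U, hUA, hU, hxU⟩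
    obtain ⟨W, hW, h⟩ := hU x hxU
    exact ⟨W, hW, h.trans hUA⟩
  · rintro ⟨W, hW, hWA⟩
    refine ⟨{y | ∃ V ∈ 𝒲.sets, setMul (setMul V {y}) V ⊆ A}, ?_, ?_, W, hW, hWA⟩
    · rintro y ⟨V, hV, hVA⟩
      have hy : y ∈ setMul (setMul V {y}) V :=
        mem_conj_iff.2 ⟨r y, 𝒲.units_subset V hV (r_mem_units y), d y,
          𝒲.units_subset V hV (d_mem_units y), d_r y, (r_d y).symm, by rw [r_mul_self, mul_d_self]⟩
      exact hVA hy
    · rintro y ⟨V, hV, hVA⟩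
      obtain ⟨V', hV', hVV⟩ := 𝒲.exists_setMul_subset V hV
      refine ⟨V', hV', fun z hz => ⟨V', hV', fun t ht => hVA ?_⟩⟩
      obtain ⟨a, ha, b, hb, hay, hyb, rfl⟩ := mem_conj_iff.1 hz
      obtain ⟨a', ha', b', hb', haz, hzb, rfl⟩ := mem_conj_iff.1 ht
      have h₁ : d (mul a y) = r b := by rw [d_mul hay, hyb]
      rw [r_mul h₁, r_mul hay] at haz
      rw [d_mul h₁] at hzb
      refine mem_conj_iff.2 ⟨mul a' a, hVV ⟨a', ha', a, ha, comp_iff.2 haz, rfl⟩, mul b b',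
        hVV ⟨b, hb, b', hb', comp_iff.2 hzb, rfl⟩, by rw [d_mul haz, hay],
        by rw [r_mul hzb, hyb], ?_⟩
      rw [mul_assoc' haz hay, ← mul_assoc' (by rw [d_mul (by rw [haz, r_mul hay]), d_mul hay, hyb])
        hzb, mul_assoc' (x := a') (by rw [haz, r_mul hay]) h₁]

end GUniformity

/-! ### Inversion and translations on the fibres of a topological groupoid. -/

section Topology

variable {G : Type*} [AlgGroupoid G] [TopologicalSpace G]

namespace IsTopologicalGroupoid

variable (hG : IsTopologicalGroupoid G)
include hG

theorem tendsto_mul {ι : Type*} {l : Filter ι} {f g : ι → G} {x y : G}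
    (hf : Tendsto f l (𝓝 x)) (hg : Tendsto g l (𝓝 y)) (hxy : d x = r y)
    (h : ∀ᶠ i in l, d (f i) = r (g i)) :
    Tendsto (fun i => mul (f i) (g i)) l (𝓝 (mul x y)) := by
  have h₁ : ContinuousWithinAt (fun p : G × G => mul p.1 p.2) {p | Comp p.1 p.2} (x, y) :=
    hG.continuousOn_mul (x, y) (comp_iff.2 hxy)
  exact h₁.tendsto.comp (tendsto_nhdsWithin_iff.2
    ⟨hf.prodMk_nhds hg, h.mono fun i hi => comp_iff.2 hi⟩)

theorem tendsto_inv {ι : Type*} {l : Filter ι} {f : ι → G} {x : G}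
    (hf : Tendsto f l (𝓝 x)) : Tendsto (fun i => inv (f i)) l (𝓝 (inv x)) :=
  (hG.continuous_inv.tendsto x).comp hf

theorem continuous_d : Continuous (d : G → G) :=
  continuous_iff_continuousAt.2 fun x => hG.tendsto_mul (hG.continuous_inv.tendsto x) tendsto_id
    (d_inv x) (Eventually.of_forall d_inv)

theorem continuous_r : Continuous (r : G → G) :=
  continuous_iff_continuousAt.2 fun x => hG.tendsto_mul tendsto_id (hG.continuous_inv.tendsto x)
    (r_inv x).symm (Eventually.of_forall fun x => (r_inv x).symm)

theorem tendsto_inv_dFibre {u : G} (hu : u ∈ units G) :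
    Tendsto inv (𝓝[dFibre u] u) (𝓝[rFibre u] u) := by
  refine tendsto_nhdsWithin_iff.2 ⟨?_, ?_⟩
  · conv_rhs => rw [← inv_of_mem_units hu]
    exact hG.tendsto_inv (tendsto_id.mono_left nhdsWithin_le_nhds)
  · filter_upwards [self_mem_nhdsWithin] with x hx
    exact (r_inv x).trans hx

theorem tendsto_inv_rFibre {u : G} (hu : u ∈ units G) :
    Tendsto inv (𝓝[rFibre u] u) (𝓝[dFibre u] u) := by
  refine tendsto_nhdsWithin_iff.2 ⟨?_, ?_⟩
  · conv_rhs => rw [← inv_of_mem_units hu]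
    exact hG.tendsto_inv (tendsto_id.mono_left nhdsWithin_le_nhds)
  · filter_upwards [self_mem_nhdsWithin] with x hx
    exact (d_inv x).trans hx

theorem map_inv_nhdsWithin_rFibre {u : G} (hu : u ∈ units G) :
    map inv (𝓝[rFibre u] u) = 𝓝[dFibre u] u := by
  refine le_antisymm (hG.tendsto_inv_rFibre hu) ?_
  have h := map_mono (m := inv) (hG.tendsto_inv_dFibre hu)
  rw [map_map] at h
  refine le_trans (le_of_eq ?_) h
  conv_lhs => rw [← map_id (f := 𝓝[dFibre u] u)]
  congr 1
  ext x
  exact (inv_inv x).symm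

/-- Left translation by `x` maps `G^{d(x)}` homeomorphically onto `G^{r(x)}`. -/
theorem map_mul_left_nhdsWithin (x : G) :
    map (mul x) (𝓝[rFibre (d x)] (d x)) = 𝓝[rFibre (r x)] x := by
  have h₁ : Tendsto (mul x) (𝓝[rFibre (d x)] (d x)) (𝓝[rFibre (r x)] x) := by
    have hev : ∀ᶠ z in 𝓝[rFibre (d x)] (d x), d x = r z :=
      eventually_mem_nhdsWithin.mono fun z hz => Eq.symm hz
    refine tendsto_nhdsWithin_iff.2 ⟨?_, ?_⟩
    · conv_rhs => rw [← mul_d_self x]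
      exact hG.tendsto_mul tendsto_const_nhds (tendsto_id.mono_left nhdsWithin_le_nhds)
        (r_d x).symm hev
    · exact hev.mono fun z hz => r_mul hz
  have h₂ : Tendsto (mul (inv x)) (𝓝[rFibre (r x)] x) (𝓝[rFibre (d x)] (d x)) := by
    have hev : ∀ᶠ z in 𝓝[rFibre (r x)] x, d (inv x) = r z :=
      eventually_mem_nhdsWithin.mono fun z hz => (d_inv x).trans (Eq.symm hz)
    refine tendsto_nhdsWithin_iff.2 ⟨?_, ?_⟩
    · exact hG.tendsto_mul tendsto_const_nhds (tendsto_id.mono_left nhdsWithin_le_nhds)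
        (d_inv x) hev
    · exact hev.mono fun z hz => (r_mul hz).trans (r_inv x)
  refine le_antisymm h₁ ?_
  have h := map_mono (m := mul x) h₂
  rw [map_map] at h
  refine le_trans (le_of_eq ?_) h
  conv_lhs => rw [← map_id (f := 𝓝[rFibre (r x)] x)]
  refine Filter.map_congr ?_
  filter_upwards [self_mem_nhdsWithin] with z hz
  exact (mul_inv_cancel_left' (Eq.symm hz)).symm

/-- Right translation by `x` maps `G_{r(x)}` homeomorphically onto `G_{d(x)}`. -/
theorem map_mul_right_nhdsWithin (x : G) :
    map (fun z => mul z x) (𝓝[dFibre (r x)] (r x)) = 𝓝[dFibre (d x)] x := by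
  have h₁ : Tendsto (fun z => mul z x) (𝓝[dFibre (r x)] (r x)) (𝓝[dFibre (d x)] x) := by
    have hev : ∀ᶠ z in 𝓝[dFibre (r x)] (r x), d z = r x := eventually_mem_nhdsWithin
    refine tendsto_nhdsWithin_iff.2 ⟨?_, ?_⟩
    · conv_rhs => rw [← r_mul_self x]
      exact hG.tendsto_mul (tendsto_id.mono_left nhdsWithin_le_nhds) tendsto_const_nhds
        (d_r x) hev
    · exact hev.mono fun z hz => d_mul hz
  have h₂ : Tendsto (fun z => mul z (inv x)) (𝓝[dFibre (d x)] x) (𝓝[dFibre (r x)] (r x)) := by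
    have hev : ∀ᶠ z in 𝓝[dFibre (d x)] x, d z = r (inv x) :=
      eventually_mem_nhdsWithin.mono fun z hz => Eq.trans hz (r_inv x).symm
    refine tendsto_nhdsWithin_iff.2 ⟨?_, ?_⟩
    · exact hG.tendsto_mul (tendsto_id.mono_left nhdsWithin_le_nhds) tendsto_const_nhds
        (r_inv x).symm hev
    · exact hev.mono fun z hz => (d_mul hz).trans (d_inv x)
  refine le_antisymm h₁ ?_
  have h := map_mono (m := fun z => mul z x) h₂
  rw [map_map] at h
  refine le_trans (le_of_eq ?_) h
  conv_lhs => rw [← map_id (f := 𝓝[dFibre (d x)] x)]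
  refine Filter.map_congr ?_
  filter_upwards [self_mem_nhdsWithin] with z hz
  exact (inv_mul_cancel_right' hz).symm

end IsTopologicalGroupoid

end Topology

end AlgGroupoid

namespace AlgGroupoid

/-! ### Properties of the topology of an arbitrary `G`-uniformity. -/

namespace GUniformity

section

variable {G : Type*} [AlgGroupoid G] (𝒲 : GUniformity G)

theorem subset_of_setMul_subset {V W : Set G} (hV : V ∈ 𝒲.sets) (h : setMul V V ⊆ W) : V ⊆ W :=
  fun x hx => h ⟨x, hx, d x, 𝒲.units_subset V hV (d_mem_units x), comp_d_self x,
    (mul_d_self x).symm⟩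

theorem mul_mem_conj {W : Set G} (hW : W ∈ 𝒲.sets) {a x : G} (ha : a ∈ W) (h : d a = r x) :
    mul a x ∈ setMul (setMul W {x}) W :=
  mem_conj_iff.2 ⟨a, ha, d x, 𝒲.units_subset W hW (d_mem_units x), h, (r_d x).symm,
    by rw [← d_mul h, mul_d_self]⟩

/-- Near a unit `r x`, every unit is the range of an element `a x` with `a` small. -/
theorem exists_of_mem_conj_unit {W : Set G} {x v : G} (hv : v ∈ units G)
    (h : v ∈ setMul (setMul W {r x}) W) : ∃ a ∈ W, d a = r x ∧ r (mul a x) = v := by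
  obtain ⟨a, ha, b, -, hax, hxb, rfl⟩ := mem_conj_iff.1 h
  rw [r_r] at hax
  refine ⟨a, ha, hax, ?_⟩
  rw [← r_of_mem_units hv, r_mul hax, r_mul, r_mul (by rw [hax, r_r])]
  rw [d_mul (by rw [hax, r_r]), hxb]

/-- Every unit in `W r(x) W` is the range of some `a x` with `a ∈ W`, and `a x` lies both in `WxW`
and in the domain fibre of `x`. -/
theorem isLocallyTransitive : @IsLocallyTransitive G _ 𝒲.topology := by
  let _ := 𝒲.topology
  intro u hu
  rw [isOpenMap_iff_nhds_le]
  rintro ⟨x, hx⟩ s hs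
  rw [mem_map, mem_nhds_subtype] at hs
  obtain ⟨t, ht, hts⟩ := hs
  obtain ⟨W, hW, hWt⟩ := (𝒲.hasBasis_nhds x).mem_iff.1 ht
  rw [mem_nhds_subtype]
  refine ⟨_, (𝒲.hasBasis_nhds (r x)).mem_of_mem hW, ?_⟩
  rintro ⟨v, hv⟩ hvW
  obtain ⟨a, ha, hax, rfl⟩ := exists_of_mem_conj_unit hv hvW
  exact @hts ⟨mul a x, (d_mul hax).trans hx⟩ (hWt (𝒲.mul_mem_conj hW ha hax))

theorem isOpenMap_rangeMap : @IsOpenMap G (units G) 𝒲.topology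
    (@instTopologicalSpaceSubtype G _ 𝒲.topology) rangeMap := by
  let _ := 𝒲.topology
  rw [isOpenMap_iff_nhds_le]
  intro x s hs
  obtain ⟨W, hW, hWt⟩ := (𝒲.hasBasis_nhds x).mem_iff.1 (mem_map.1 hs)
  rw [mem_nhds_subtype]
  refine ⟨_, (𝒲.hasBasis_nhds (r x)).mem_of_mem hW, ?_⟩
  rintro ⟨v, hv⟩ hvW
  obtain ⟨a, ha, hax, rfl⟩ := exists_of_mem_conj_unit hv hvW
  exact hWt (𝒲.mul_mem_conj hW ha hax)

theorem continuous_inv : @Continuous G G 𝒲.topology 𝒲.topology inv := by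
  let _ := 𝒲.topology
  refine continuous_iff_continuousAt.2 fun x => ?_
  refine ((𝒲.hasBasis_nhds x).tendsto_iff (𝒲.hasBasis_nhds (inv x))).2 fun W hW => ⟨W, hW, ?_⟩
  intro z hz
  obtain ⟨a, ha, b, hb, hax, hxb, rfl⟩ := mem_conj_iff.1 hz
  have h : d (mul a x) = r b := by rw [d_mul hax, hxb]
  refine mem_conj_iff.2 ⟨inv b, (𝒲.inv_mem_iff hW).2 hb, inv a, (𝒲.inv_mem_iff hW).2 ha,
    by rw [d_inv, r_inv, hxb], by rw [d_inv, r_inv, hax], ?_⟩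
  rw [mul_inv_rev' h, mul_inv_rev' hax, mul_assoc' (by rw [d_inv, r_inv, hxb])
    (by rw [d_inv, r_inv, hax])]

end

/-! ### Uniformities whose traces are neighbourhood bases in the fibres. -/

section

variable {G : Type*} [AlgGroupoid G] [TopologicalSpace G] {𝒲 : GUniformity G}

/-- The sets `W ∩ G^u`, `W ∈ 𝒲`, form a neighbourhood basis of `u` in `G^u`, for all units `u`. -/
def IsFibreBasis (𝒲 : GUniformity G) : Prop :=
  ∀ u ∈ units G, (𝓝[rFibre u] u).HasBasis (· ∈ 𝒲.sets) (fun W => W ∩ rFibre u)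

namespace IsFibreBasis

variable (h𝒲 : 𝒲.IsFibreBasis)
include h𝒲

theorem compatibleWithRFibres : 𝒲.CompatibleWithRFibres := by
  intro u hu U hU huU
  obtain ⟨W, hW, hWU⟩ := (h𝒲 u hu).mem_iff.1 (mem_nhdsWithin_of_mem_nhds (hU.mem_nhds huU))
  refine ⟨W, hW, subset_inter hWU inter_subset_right, ?_⟩
  obtain ⟨O, hO, huO, hOW⟩ := mem_nhdsWithin.1 ((h𝒲 u hu).mem_of_mem hW)
  exact ⟨O, hO, huO, hOW⟩

theorem mem_rFibre {u : G} (hu : u ∈ units G) {W : Set G} (hW : W ∈ 𝒲.sets) :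
    W ∈ 𝓝[rFibre u] u :=
  mem_of_superset ((h𝒲 u hu).mem_of_mem hW) inter_subset_left

variable (hG : IsTopologicalGroupoid G)
include hG

theorem hasBasis_dFibre {u : G} (hu : u ∈ units G) :
    (𝓝[dFibre u] u).HasBasis (· ∈ 𝒲.sets) (fun W => W ∩ dFibre u) := by
  rw [← hG.map_inv_nhdsWithin_rFibre hu]
  refine ((h𝒲 u hu).map inv).congr (fun _ => Iff.rfl) fun W hW => ?_
  ext x
  constructor
  · rintro ⟨y, ⟨hyW, hyu⟩, rfl⟩
    exact ⟨(𝒲.inv_mem_iff hW).2 hyW, (d_inv y).trans hyu⟩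
  · rintro ⟨hxW, hxu⟩
    exact ⟨inv x, ⟨(𝒲.inv_mem_iff hW).2 hxW, (r_inv x).trans hxu⟩, inv_inv x⟩

/-- The right-hand side involves only the original fibre topologies, so every later comparison
becomes a computation with `(a, b) ↦ a x b`. -/
theorem nhds_eq_map (x : G) : 𝒲.nhds x = map (fun p : G × G => mul (mul p.1 x) p.2)
    (𝓝[dFibre (r x)] (r x) ×ˢ 𝓝[rFibre (d x)] (d x)) := by
  have h₁ := (h𝒲.hasBasis_dFibre hG (r_mem_units x)).prod_same_index (h𝒲 (d x) (d_mem_units x))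
    fun {W₁ W₂} hW₁ hW₂ => by
      obtain ⟨W₃, hW₃, h⟩ := 𝒲.exists_subset_inter W₁ hW₁ W₂ hW₂
      exact ⟨W₃, hW₃, inter_subset_inter_left _ fun z hz => (h hz).1,
        inter_subset_inter_left _ fun z hz => (h hz).2⟩
  refine (𝒲.hasBasis_nhds x).eq_of_same_basis ((h₁.map _).congr (fun _ => Iff.rfl) fun W hW => ?_)
  ext z
  rw [mem_conj_iff]
  constructor
  · rintro ⟨⟨a, b⟩, ⟨⟨ha, hax⟩, hb, hbx⟩, rfl⟩
    exact ⟨a, ha, b, hb, hax, Eq.symm hbx, rfl⟩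
  · rintro ⟨a, ha, b, hb, hax, hxb, rfl⟩
    exact ⟨(a, b), ⟨⟨ha, hax⟩, hb, hxb.symm⟩, rfl⟩

theorem nhds_le (x : G) : 𝒲.nhds x ≤ 𝓝 x := by
  rw [h𝒲.nhds_eq_map hG]
  have hl : ∀ᶠ p in 𝓝[dFibre (r x)] (r x) ×ˢ 𝓝[rFibre (d x)] (d x), d p.1 = r x :=
    tendsto_fst.eventually eventually_mem_nhdsWithin
  have hr : ∀ᶠ p in 𝓝[dFibre (r x)] (r x) ×ˢ 𝓝[rFibre (d x)] (d x), r p.2 = d x :=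
    tendsto_snd.eventually eventually_mem_nhdsWithin
  have h₁ := hG.tendsto_mul (tendsto_fst.mono_right nhdsWithin_le_nhds) tendsto_const_nhds
    (d_r x) hl
  rw [r_mul_self] at h₁
  have h₂ := hG.tendsto_mul h₁ (tendsto_snd.mono_right nhdsWithin_le_nhds) (r_d x).symm
    (by filter_upwards [hl, hr] with p hp hp'; rw [d_mul hp, hp'])
  rwa [mul_d_self] at h₂

/-- Freezing the left factor at `r(x)` leaves `b ↦ x b`, a homeomorphism onto the fibre through `x`.
-/
theorem nhdsWithin_rFibre_le (x : G) : 𝓝[rFibre (r x)] x ≤ 𝒲.nhds x := by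
  rw [h𝒲.nhds_eq_map hG, ← hG.map_mul_left_nhdsWithin x]
  have h : Tendsto (fun z => (r x, z)) (𝓝[rFibre (d x)] (d x))
      (𝓝[dFibre (r x)] (r x) ×ˢ 𝓝[rFibre (d x)] (d x)) :=
    Tendsto.prodMk (tendsto_const_pure.mono_right (pure_le_nhdsWithin (d_r x))) tendsto_id
  refine le_trans (le_of_eq ?_) (map_mono h)
  rw [map_map]
  congr 1
  ext z
  simp only [Function.comp_apply, r_mul_self]

theorem nhdsWithin_dFibre_le (x : G) : 𝓝[dFibre (d x)] x ≤ 𝒲.nhds x := by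
  rw [h𝒲.nhds_eq_map hG, ← hG.map_mul_right_nhdsWithin x]
  have h : Tendsto (fun z => (z, d x)) (𝓝[dFibre (r x)] (r x))
      (𝓝[dFibre (r x)] (r x) ×ˢ 𝓝[rFibre (d x)] (d x)) :=
    Tendsto.prodMk tendsto_id (tendsto_const_pure.mono_right (pure_le_nhdsWithin (r_d x)))
  refine le_trans (le_of_eq ?_) (map_mono h)
  rw [map_map]
  refine Filter.map_congr ?_
  filter_upwards [self_mem_nhdsWithin] with z hz
  have hz' : d z = r x := hz
  simp only [Function.comp_apply]
  rw [← d_mul hz', mul_d_self]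

/-- Conjugation by `y` is continuous at the unit `r y` of the isotropy group. -/
theorem exists_conj_mem (y : G) {V : Set G} (hV : V ∈ 𝒲.sets) :
    ∃ W ∈ 𝒲.sets, ∀ w ∈ W, r w = r y → d w = r y → mul (inv y) (mul w y) ∈ V := by
  have hd : ∀ᶠ w in 𝓝[rFibre (r y) ∩ dFibre (r y)] (r y), d w = r y :=
    eventually_mem_nhdsWithin.mono fun w hw => hw.2
  have hr : ∀ᶠ w in 𝓝[rFibre (r y) ∩ dFibre (r y)] (r y), r w = r y :=
    eventually_mem_nhdsWithin.mono fun w hw => hw.1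
  have h₁ := hG.tendsto_mul (tendsto_id.mono_left nhdsWithin_le_nhds) tendsto_const_nhds
    (d_r y) hd
  rw [r_mul_self] at h₁
  have h₂ : ∀ᶠ w in 𝓝[rFibre (r y) ∩ dFibre (r y)] (r y), d (inv y) = r (mul w y) := by
    filter_upwards [hd, hr] with w h h'
    rw [r_mul h, h', d_inv]
  have h₃ : Tendsto (fun w => mul (inv y) (mul w y)) (𝓝[rFibre (r y) ∩ dFibre (r y)] (r y))
      (𝓝[rFibre (d y)] (d y)) := by
    refine tendsto_nhdsWithin_iff.2 ⟨hG.tendsto_mul tendsto_const_nhds h₁ (d_inv y) h₂, ?_⟩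
    exact h₂.mono fun w hw => (r_mul hw).trans (r_inv y)
  have h₄ := h₃.eventually (h𝒲.mem_rFibre (d_mem_units y) hV)
  -- The domain condition becomes a hypothesis, so that the basis of the range fibre applies.
  rw [nhdsWithin_inter', eventually_inf_principal] at h₄
  obtain ⟨W, hW, h⟩ := (h𝒲 _ (r_mem_units y)).mem_iff.1 h₄
  exact ⟨W, hW, fun w hw hr hd => h ⟨hw, hr⟩ hd⟩

/-- One has `(a x b)(a' y b') = a (xy) · (y⁻¹ (b a') y) b'`. Here `b a'` is a small element of the
isotropy group at `r(y)`, so its conjugate by `y` is small as well. -/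
theorem tendsto_mul {x y : G} (hxy : d x = r y) : Tendsto (fun p : G × G => mul p.1 p.2)
    ((𝒲.nhds x ×ˢ 𝒲.nhds y) ⊓ 𝓟 {p | Comp p.1 p.2}) (𝒲.nhds (mul x y)) := by
  refine (𝒲.hasBasis_nhds _).tendsto_right_iff.2 fun V hV => ?_
  obtain ⟨V₁, hV₁, hVV₁⟩ := 𝒲.exists_setMul_subset V hV
  obtain ⟨W, hW, hWV⟩ := h𝒲.exists_conj_mem hG y hV₁
  obtain ⟨W₁, hW₁, hWW₁⟩ := 𝒲.exists_setMul_subset W hW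
  obtain ⟨U, hU, hUVW⟩ := 𝒲.exists_subset_inter V₁ hV₁ W₁ hW₁
  rw [eventually_inf_principal]
  filter_upwards [prod_mem_prod ((𝒲.hasBasis_nhds x).mem_of_mem hU)
    ((𝒲.hasBasis_nhds y).mem_of_mem hU)]
  rintro ⟨p, q⟩ ⟨hp, hq⟩ hpq
  obtain ⟨a, ha, b, hb, hax, hxb, rfl⟩ := mem_conj_iff.1 hp
  obtain ⟨a', ha', b', hb', hax', hxb', rfl⟩ := mem_conj_iff.1 hq
  have hbr : r b = r y := by rw [← hxb, hxy]
  have h₁ : d (mul a x) = r b := by rw [d_mul hax, hxb]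
  have h₂ : d (mul a' y) = r b' := by rw [d_mul hax', hxb']
  have hba : d b = r a' := by
    have h := Comp.d_eq_r hpq
    simp only at h
    rwa [d_mul h₁, r_mul h₂, r_mul hax'] at h
  have hw := hWV (mul b a') (hWW₁ ⟨b, (hUVW hb).2, a', (hUVW ha').2, comp_iff.2 hba, rfl⟩)
    (by rw [r_mul hba, hbr]) (by rw [d_mul hba, hax'])
  have h₃ : d (mul (inv y) (mul (mul b a') y)) = r b' := by
    simp (maxDischargeDepth := 8) only [d_mul, r_mul, hba, hax', hbr, d_inv, hxb']
  refine mem_conj_iff.2 ⟨a, 𝒲.subset_of_setMul_subset hV₁ hVV₁ (hUVW ha).1,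
    mul (mul (inv y) (mul (mul b a') y)) b', hVV₁ ⟨_, hw, b', (hUVW hb').1, comp_iff.2 h₃, rfl⟩,
    by rw [hax, r_mul hxy], ?_, ?_⟩
  · rw [d_mul hxy, r_mul h₃, r_mul, r_inv]
    simp (maxDischargeDepth := 8) only [r_mul, d_mul, hba, hax', hbr, d_inv]
  · simp (maxDischargeDepth := 8) only [mul_assoc', d_mul, r_mul, hba, hax, hax', hbr, d_inv, r_inv, hxy,
      hxb', mul_inv_cancel_left']

theorem isTopologicalGroupoid : @IsTopologicalGroupoid G _ 𝒲.topology := by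
  refine @IsTopologicalGroupoid.mk G _ 𝒲.topology 𝒲.continuous_inv ?_
  rintro ⟨x, y⟩ hxy
  have h := h𝒲.tendsto_mul hG (Comp.d_eq_r hxy)
  let _ := 𝒲.topology
  rw [ContinuousWithinAt, nhdsWithin, nhds_prod_eq]
  exact h

theorem topology_le : 𝒲.topology ≤ ‹TopologicalSpace G› :=
  le_of_nhds_le_nhds (h𝒲.nhds_le hG)

/-- For `y` near `x`, local transitivity gives `z` near `x` in `G_{d(x)}` with `r(z) = r(y)`. Then
`y = z (z⁻¹ y)`, where `z = a x` with `a` small and `z⁻¹ y` is near `d(x)`. -/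
theorem nhds_le_of_isLocallyTransitive (hlt : IsLocallyTransitive G) (x : G) :
    𝓝 x ≤ 𝒲.nhds x := by
  refine (𝒲.hasBasis_nhds x).ge_iff.2 fun W hW => ?_
  have h₁ : ∀ᶠ z in 𝓝[dFibre (d x)] x, ∃ a ∈ W, d a = r x ∧ z = mul a x := by
    rw [← hG.map_mul_right_nhdsWithin x, eventually_map]
    filter_upwards [(h𝒲.hasBasis_dFibre hG (r_mem_units x)).mem_of_mem hW] with a ha
    exact ⟨a, ha.1, ha.2, rfl⟩
  have h₂ : ∀ᶠ p : G × G in 𝓝[dFibre (d x)] x ×ˢ 𝓝 x,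
      r p.1 = r p.2 → mul (inv p.1) p.2 ∈ W := by
    refine eventually_inf_principal (s := {p : G × G | r p.1 = r p.2}).1 ?_
    have hev : ∀ᶠ p : G × G in (𝓝[dFibre (d x)] x ×ˢ 𝓝 x) ⊓ 𝓟 {p | r p.1 = r p.2},
        d (inv p.1) = r p.2 := by
      rw [eventually_inf_principal]
      exact Eventually.of_forall fun p hp => (d_inv _).trans hp
    have hd : ∀ᶠ p : G × G in (𝓝[dFibre (d x)] x ×ˢ 𝓝 x) ⊓ 𝓟 {p | r p.1 = r p.2},
        d p.1 = d x :=
      (tendsto_fst.eventually eventually_mem_nhdsWithin).filter_mono inf_le_left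
    refine (tendsto_nhdsWithin_iff.2 ⟨hG.tendsto_mul (hG.tendsto_inv
      ((tendsto_fst.mono_right nhdsWithin_le_nhds).mono_left inf_le_left))
      (tendsto_snd.mono_left inf_le_left) (d_inv x) hev, ?_⟩).eventually
      (h𝒲.mem_rFibre (d_mem_units x) hW)
    filter_upwards [hev, hd] with p hp hp'
    exact (r_mul hp).trans ((r_inv _).trans hp')
  obtain ⟨P, hP, Q, hQ, hPQ⟩ := eventually_prod_iff.1 h₂
  have h₃ := (hlt (d x) (d_mem_units x)).image_mem_nhds (x := ⟨x, rfl⟩)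
    (preimage_coe_mem_nhds_subtype.2 (h₁.and hP))
  have hc : Continuous (rangeMap : G → units G) := hG.continuous_r.subtype_mk _
  filter_upwards [hQ, hc.continuousAt.preimage_mem_nhds h₃] with y hy hy'
  obtain ⟨⟨z, hzd⟩, ⟨⟨a, ha, hax, hza⟩, hzP⟩, hzy⟩ := hy'
  have hzy' : r z = r y := congrArg Subtype.val hzy
  have hzd' : d z = d x := hzd
  refine mem_conj_iff.2 ⟨a, ha, mul (inv z) y, hPQ hzP hy hzy', hax, ?_, ?_⟩
  · rw [r_mul (by rw [d_inv, hzy']), r_inv, hzd']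
  · rw [← hza, mul_inv_cancel_left' hzy']

/-- Write the points near `a` and `b` as `s a` and `t⁻¹ b`, with `s` near `r(a)` and `t` near
`r(b)`. Then `(s a)(t⁻¹ b)⁻¹ = s (a b⁻¹) t`, the form in `nhds_eq_map`. -/
theorem map_mul_inv_nhdsWithin {e a b : G} (ha : d a = e) (hb : d b = e) :
    map (fun p : G × G => mul p.1 (inv p.2)) (𝓝[dFibre e] a ×ˢ 𝓝[dFibre e] b) =
      𝒲.nhds (mul a (inv b)) := by
  subst ha
  have hab : d a = r (inv b) := by rw [r_inv, hb]
  rw [h𝒲.nhds_eq_map hG, r_mul hab, d_mul hab, d_inv, ← hG.map_mul_right_nhdsWithin a, ← hb,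
    ← hG.map_mul_right_nhdsWithin b, prod_map_map_eq, map_map,
    ← hG.map_inv_nhdsWithin_rFibre (r_mem_units b)]
  conv_lhs => rw [← map_id (f := 𝓝[dFibre (r a)] (r a)), prod_map_map_eq, map_map]
  refine Filter.map_congr ?_
  filter_upwards [prod_mem_prod self_mem_nhdsWithin self_mem_nhdsWithin] with p hp
  have h₁ : d p.1 = r a := hp.1
  have h₂ : r p.2 = r b := hp.2
  simp only [Function.comp_apply, id]
  rw [mul_inv_rev' (by rw [d_inv, h₂]), inv_inv, mul_assoc' h₁ (by rw [r_mul (by rw [d_inv, h₂]), r_inv, hb]),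
    ← mul_assoc' hab (by rw [d_inv, h₂]),
    mul_assoc' (x := p.1) (by rw [r_mul hab, h₁]) (by rw [d_mul hab, d_inv, h₂])]

end IsFibreBasis

end

end GUniformity

end AlgGroupoid

/-! ### Open quotients, local compactness, countability and Borel sets. -/

theorem isOpenQuotientMap_of_map_nhds_eq {X Y : Type*} {_ : TopologicalSpace X}
    {_ : TopologicalSpace Y} {f : X → Y} (hf : Function.Surjective f)
    (h : ∀ x, map f (𝓝 x) = 𝓝 (f x)) : IsOpenQuotientMap f :=
  ⟨hf, continuous_iff_continuousAt.2 fun x => (h x).le, isOpenMap_iff_nhds_le.2 fun x => (h x).ge⟩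

theorem IsOpenQuotientMap.secondCountableTopology {X Y : Type*} {_ : TopologicalSpace X}
    {_ : TopologicalSpace Y} [SecondCountableTopology X] {f : X → Y} (hf : IsOpenQuotientMap f) :
    SecondCountableTopology Y :=
  hf.isQuotientMap.secondCountableTopology hf.isOpenMap

namespace AlgGroupoid

namespace GUniformity

namespace IsFibreBasis

variable {G : Type*} [AlgGroupoid G] [TopologicalSpace G] {𝒲 : GUniformity G}
variable (h𝒲 : 𝒲.IsFibreBasis) (hG : IsTopologicalGroupoid G)
include h𝒲 hG

theorem induced_eq {s : Set G} (hs : ∀ x ∈ s, 𝓝[s] x ≤ 𝒲.nhds x) :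
    TopologicalSpace.induced (Subtype.val : s → G) 𝒲.topology =
      TopologicalSpace.induced (Subtype.val : s → G) ‹_› := by
  refine le_antisymm (induced_mono (h𝒲.topology_le hG)) (le_of_nhds_le_nhds fun x => ?_)
  rw [nhds_induced, @nhds_induced _ _ 𝒲.topology]
  have h := comap_mono (m := (Subtype.val : s → G)) (hs x x.2)
  refine le_trans ?_ h
  rw [nhdsWithin, comap_inf, comap_principal, Subtype.coe_preimage_self, principal_univ, inf_top_eq]

theorem induced_rFibre (u : G) :
    TopologicalSpace.induced (Subtype.val : rFibre u → G) 𝒲.topology =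
      TopologicalSpace.induced (Subtype.val : rFibre u → G) ‹_› :=
  h𝒲.induced_eq hG fun x hx => by
    have hx' : r x = u := hx
    exact hx' ▸ h𝒲.nhdsWithin_rFibre_le hG x

theorem induced_dFibre (u : G) :
    TopologicalSpace.induced (Subtype.val : dFibre u → G) 𝒲.topology =
      TopologicalSpace.induced (Subtype.val : dFibre u → G) ‹_› :=
  h𝒲.induced_eq hG fun x hx => by
    have hx' : d x = u := hx
    exact hx' ▸ h𝒲.nhdsWithin_dFibre_le hG x

/-- Transitivity enters only here, for surjectivity: `g = (g b) b⁻¹` for any `b` from `e` to `d(g)`.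
-/
theorem isOpenQuotientMap_mul_inv (htrans : IsTransitive G) {e : G} (he : e ∈ units G) :
    @IsOpenQuotientMap (dFibre e × dFibre e) G _ 𝒲.topology
      (fun p => mul (p.1 : G) (inv (p.2 : G))) := by
  have key (p : dFibre e × dFibre e) : map (fun p : dFibre e × dFibre e => mul (p.1 : G) (inv p.2))
      (𝓝 p) = 𝒲.nhds (mul (p.1 : G) (inv (p.2 : G))) := by
    rw [← h𝒲.map_mul_inv_nhdsWithin hG p.1.2 p.2.2, ← map_nhds_subtype_val p.1,
      ← map_nhds_subtype_val p.2, prod_map_map_eq, map_map, ← nhds_prod_eq]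
    rfl
  refine isOpenQuotientMap_of_map_nhds_eq (fun g => ?_) key
  obtain ⟨b, hb, hbe⟩ := htrans (d g) (d_mem_units g) e he
  exact ⟨(⟨mul g b, (d_mul hb.symm).trans hbe⟩, ⟨b, hbe⟩), mul_inv_cancel_right' hb.symm⟩

theorem locallyCompactSpace (htrans : IsTransitive G) [T2Space G] [LocallyCompactSpace G] :
    @LocallyCompactSpace G 𝒲.topology := by
  rcases isEmpty_or_nonempty G with hE | ⟨⟨g⟩⟩
  · exact @LocallyCompactSpace.mk G 𝒲.topology fun x => hE.elim x
  · have : LocallyCompactSpace (dFibre (d g)) :=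
      (isClosed_eq hG.continuous_d continuous_const).isClosedEmbedding_subtypeVal.locallyCompactSpace
    exact @IsOpenQuotientMap.locallyCompactSpace _ _ _ 𝒲.topology _ _
      (h𝒲.isOpenQuotientMap_mul_inv hG htrans (d_mem_units g))

theorem secondCountableTopology (htrans : IsTransitive G) [SecondCountableTopology G] :
    @SecondCountableTopology G 𝒲.topology := by
  rcases isEmpty_or_nonempty G with hE | ⟨⟨g⟩⟩
  · exact @Finite.toSecondCountableTopology G 𝒲.topology _
  · exact (h𝒲.isOpenQuotientMap_mul_inv hG htrans (d_mem_units g)).secondCountableTopology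

theorem t2Space [T2Space G] : @T2Space G 𝒲.topology :=
  t2Space_antitone (h𝒲.topology_le hG) inferInstance

end IsFibreBasis

end GUniformity

/-- A second countable locally compact topology has the same Borel sets as any coarser Hausdorff
topology. -/
theorem borel_eq_borel_of_locallyCompact {X : Type*} {t t' : TopologicalSpace X}
    (hle : t' ≤ t) (hT2 : @T2Space X t) (hlc : @LocallyCompactSpace X t')
    (hsc : @SecondCountableTopology X t') : @borel X t' = @borel X t := by
  refine le_antisymm (MeasurableSpace.generateFrom_le fun U hU => ?_) (borel_anti hle)
  -- A `t'`-open set is a countable union of `t'`-compact sets; these are compact, hence closed, for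
  -- the coarser Hausdorff topology `t`.
  have h₁ : @IsSigmaCompact X t' U := by
    have : LocallyCompactSpace U := IsOpen.locallyCompactSpace hU
    exact isSigmaCompact_iff_sigmaCompactSpace.2 inferInstance
  obtain ⟨K, hK, rfl⟩ := h₁
  refine MeasurableSet.iUnion fun n => ?_
  have h₂ : @IsCompact X t (K n) := by
    have h := @IsCompact.image X X t' t _ _ (hK n) (continuous_id_of_le hle)
    rwa [image_id] at h
  exact MeasurableSet.of_compl
    (MeasurableSpace.measurableSet_generateFrom (@IsCompact.isClosed X t hT2 _ h₂).isOpen_compl)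

/-! ### The uniformity of a sequence of functions. -/

section Construction

variable {G : Type*} [AlgGroupoid G]

/-- The elements of `G` which, by left translation, move the first `n` functions of the sequence `f`
by at most `2⁻ⁿ`. -/
def almostInvariant (f : ℕ → G → ℝ) (n : ℕ) : Set G :=
  {g | ∀ i < n, ∀ z, d g = r z → |f i (mul g z) - f i z| ≤ (1 / 2) ^ n}

theorem almostInvariant_anti (f : ℕ → G → ℝ) : Antitone (almostInvariant f) :=
  fun _ _ hmn _ hg i hi z hz => (hg i (hi.trans_le hmn) z hz).trans
    (pow_le_pow_of_le_one (by norm_num) (by norm_num) hmn)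

/-- Passing through `f i (yz)`, two errors of `2⁻⁽ⁿ⁺¹⁾` add up to `2⁻ⁿ`. -/
theorem setMul_almostInvariant_subset (f : ℕ → G → ℝ) (n : ℕ) :
    setMul (almostInvariant f (n + 1)) (almostInvariant f (n + 1)) ⊆ almostInvariant f n := by
  rintro _ ⟨x, hx, y, hy, hxy, rfl⟩ i hi z hz
  replace hxy := hxy.d_eq_r
  rw [d_mul hxy] at hz
  have h₁ := hx i (hi.trans (Nat.lt_succ_self n)) (mul y z) (by rw [hxy, r_mul hz])
  have h₂ := hy i (hi.trans (Nat.lt_succ_self n)) z hz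
  rw [mul_assoc' hxy hz]
  refine (abs_sub_le _ (f i (mul y z)) _).trans ((add_le_add h₁ h₂).trans (le_of_eq ?_))
  rw [pow_succ]
  ring

theorem inv_mem_almostInvariant {f : ℕ → G → ℝ} {n : ℕ} {x : G} (hx : x ∈ almostInvariant f n) :
    inv x ∈ almostInvariant f n := by
  intro i hi z hz
  rw [d_inv] at hz
  have h := hx i hi (mul (inv x) z) (by rw [r_mul (by rw [d_inv, hz]), r_inv])
  rwa [mul_inv_cancel_left' hz, abs_sub_comm] at h

/-- The countable `G`-uniformity defined by a sequence of functions on `G`. -/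
def uniformityOfSeq (f : ℕ → G → ℝ) : GUniformity G where
  sets := range (almostInvariant f)
  nonempty := range_nonempty _
  units_subset := by
    rintro _ ⟨n, rfl⟩ _ ⟨x, rfl⟩ i - z hz
    rw [d_r] at hz
    rw [hz, r_mul_self, sub_self, abs_zero]
    positivity
  exists_subset_inter := by
    rintro _ ⟨m, rfl⟩ _ ⟨n, rfl⟩
    exact ⟨_, ⟨max m n, rfl⟩, subset_inter (almostInvariant_anti f (le_max_left m n))
      (almostInvariant_anti f (le_max_right m n))⟩
  exists_setMul_subset := by
    rintro _ ⟨n, rfl⟩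
    exact ⟨_, ⟨n + 1, rfl⟩, setMul_almostInvariant_subset f n⟩
  symm := by
    rintro _ ⟨n, rfl⟩
    refine Subset.antisymm (fun x hx => inv_mem_almostInvariant hx) fun x hx => ?_
    have h := inv_mem_almostInvariant (show inv x ∈ almostInvariant f n from hx)
    rwa [inv_inv] at h

variable [TopologicalSpace G]

namespace IsTopologicalGroupoid

theorem isCompact_inv_mul (hG : IsTopologicalGroupoid G) [T2Space G] {K S : Set G}
    (hK : IsCompact K) (hS : IsCompact S) : IsCompact (setMul (setInv K) S) := by
  have hc : IsClosed {p : G × G | r p.1 = r p.2} :=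
    isClosed_eq (hG.continuous_r.comp continuous_fst) (hG.continuous_r.comp continuous_snd)
  have h := ((hK.prod hS).inter_right hc).image_of_continuousOn
    (f := fun p : G × G => mul (inv p.1) p.2) ?_
  · convert h using 1
    ext z
    constructor
    · rintro ⟨x, hx, y, hy, hxy, rfl⟩
      refine ⟨(inv x, y), ⟨⟨hx, hy⟩, ?_⟩, by simp only [inv_inv]⟩
      exact (r_inv x).trans hxy.d_eq_r
    · rintro ⟨⟨x, y⟩, ⟨⟨hx, hy⟩, hxy⟩, rfl⟩
      refine ⟨inv x, ?_, y, hy, comp_iff.2 ((d_inv x).trans hxy), rfl⟩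
      show inv (inv x) ∈ K
      rwa [inv_inv]
  · refine hG.continuousOn_mul.comp (f := fun p : G × G => (inv p.1, p.2))
      ((hG.continuous_inv.comp continuous_fst).prodMk continuous_snd).continuousOn ?_
    rintro p ⟨-, hp⟩
    exact comp_iff.2 ((d_inv p.1).trans hp)

/-- Left translates of a compactly supported function depend uniformly continuously on the
translating element, along a fibre of the domain map. -/
theorem eventually_forall_abs_sub_le (hG : IsTopologicalGroupoid G) [T2Space G]
    [LocallyCompactSpace G] {u : G} (hu : u ∈ units G) {f : G → ℝ} (hf : Continuous f)
    (hfc : HasCompactSupport f) {ε : ℝ} (hε : 0 < ε) :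
    ∀ᶠ g in 𝓝[dFibre u] u, ∀ z, d g = r z → |f (mul g z) - f z| ≤ ε := by
  obtain ⟨K, hK, hKu⟩ := exists_compact_mem_nhds u
  -- For `g ∈ K`, both `f z` and `f (gz)` vanish unless `z` lies in this union, so only a compact
  -- set of `z` needs a uniform bound.
  have hC : IsCompact ((tsupport f ∪ setMul (setInv K) (tsupport f)) ∩ rFibre u) :=
    (hfc.isCompact.union (hG.isCompact_inv_mul hK hfc.isCompact)).inter_right
      (isClosed_eq hG.continuous_r continuous_const)
  have hev : ∀ᶠ g in 𝓝 u, ∀ z ∈ (tsupport f ∪ setMul (setInv K) (tsupport f)) ∩ rFibre u,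
      d g = r z → |f (mul g z) - f z| ≤ ε := by
    -- On composable pairs `f (gz) - f z` is continuous and vanishes at `(u, z)`; compactness gives
    -- uniformity in `z`.
    refine hC.eventually_forall_of_forall_eventually fun z hz => ?_
    refine eventually_inf_principal (s := {p : G × G | d p.1 = r p.2}).1 ?_
    have hzu : r z = u := hz.2
    have h₁ : Tendsto (fun p : G × G => mul p.1 p.2) (𝓝 (u, z) ⊓ 𝓟 {p | d p.1 = r p.2})
        (𝓝 (mul u z)) :=
      hG.tendsto_mul ((continuous_fst.tendsto _).mono_left inf_le_left)
        ((continuous_snd.tendsto _).mono_left inf_le_left) ((d_of_mem_units hu).trans hzu.symm)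
        (mem_inf_of_right (mem_principal_self _))
    have h₂ : Tendsto (fun p : G × G => p.2) (𝓝 (u, z) ⊓ 𝓟 {p | d p.1 = r p.2}) (𝓝 z) :=
      (continuous_snd.tendsto _).mono_left inf_le_left
    have h₃ := (((hf.tendsto _).comp h₁).sub ((hf.tendsto _).comp h₂)).abs
    rw [← hzu, r_mul_self, sub_self, abs_zero] at h₃
    rw [← hzu]
    exact h₃.eventually_le_const hε
  filter_upwards [nhdsWithin_le_nhds hev, nhdsWithin_le_nhds hKu, self_mem_nhdsWithin]
    with g hg hgK hgu z hz
  have hzu : r z = u := hz.symm.trans hgu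
  by_cases hzC : z ∈ tsupport f ∪ setMul (setInv K) (tsupport f)
  · exact hg z ⟨hzC, hzu⟩ hz
  · have h₁ : f z = 0 := image_eq_zero_of_notMem_tsupport fun h => hzC (Or.inl h)
    have h₂ : f (mul g z) = 0 := by
      refine image_eq_zero_of_notMem_tsupport fun h => hzC (Or.inr ?_)
      refine ⟨inv g, ?_, mul g z, h, comp_iff.2 ?_, (inv_mul_cancel_left' hz).symm⟩
      · show inv (inv g) ∈ K
        rwa [inv_inv]
      · rw [d_inv, r_mul hz]
    rw [h₁, h₂, sub_self, abs_zero]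
    exact hε.le

theorem isFibreBasis_uniformityOfSeq (hG : IsTopologicalGroupoid G) [T2Space G]
    [LocallyCompactSpace G] {f : ℕ → G → ℝ} (hf : ∀ n, Continuous (f n))
    (hfc : ∀ n, HasCompactSupport (f n))
    (hsep : ∀ x, ∀ U ∈ 𝓝 x, ∃ n, f n x = 1 ∧ ∀ y ∉ U, f n y = 0) :
    (uniformityOfSeq f).IsFibreBasis := by
  intro u hu
  refine ⟨fun A => ⟨fun hA => ?_, ?_⟩⟩
  · have hA' := hG.tendsto_inv_dFibre hu hA
    obtain ⟨U, hU, hUA⟩ := mem_nhdsWithin_iff_exists_mem_nhds_inter.1 hA'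
    obtain ⟨n, hn, hnU⟩ := hsep u U hU
    -- Index `n + 1` puts `f n` among the controlled functions with a bound below `1`. Testing `x⁻¹`
    -- on `z = u` compares `f n (x⁻¹)` with `f n u = 1`, forcing `x⁻¹ ∈ U`.
    refine ⟨_, ⟨n + 1, rfl⟩, ?_⟩
    rintro x ⟨hx, hxu⟩
    have hdx : d (inv x) = u := (d_inv x).trans hxu
    have h := inv_mem_almostInvariant hx n (Nat.lt_succ_self n) u
      (by rw [hdx, r_of_mem_units hu])
    have hxu' : mul (inv x) u = inv x := by
      rw [← hdx, mul_d_self]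
    rw [hxu', hn] at h
    have hxU : inv x ∈ U := by
      by_contra hxU
      rw [hnU _ hxU, zero_sub, abs_neg, abs_one] at h
      exact absurd h (not_le.2 (pow_lt_one₀ (by norm_num) (by norm_num) (Nat.succ_ne_zero n)))
    have h' := hUA ⟨hxU, hdx⟩
    rwa [mem_preimage, inv_inv] at h'
  · rintro ⟨_, ⟨n, rfl⟩, hnA⟩
    have h : almostInvariant f n ∈ 𝓝[dFibre u] u := by
      refine (eventually_all_finite (finite_lt_nat n)).2 fun i _ =>
        hG.eventually_forall_abs_sub_le hu (hf i) (hfc i) (by positivity)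
    filter_upwards [hG.tendsto_inv_rFibre hu h, self_mem_nhdsWithin] with x hx hxu
    have h' := inv_mem_almostInvariant hx
    rw [inv_inv] at h'
    exact hnA ⟨h', hxu⟩

end IsTopologicalGroupoid

end Construction

/-- In a second countable locally compact Hausdorff space, countably many compactly supported
continuous functions separate the points from the complements of their neighbourhoods. -/
theorem exists_seq_hasCompactSupport (X : Type*) [TopologicalSpace X] [T2Space X]
    [LocallyCompactSpace X] [SecondCountableTopology X] :
    ∃ f : ℕ → X → ℝ, (∀ n, Continuous (f n)) ∧ (∀ n, HasCompactSupport (f n)) ∧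
      ∀ x, ∀ U ∈ 𝓝 x, ∃ n, f n x = 1 ∧ ∀ y ∉ U, f n y = 0 := by
  obtain ⟨B, hBc, -, hB⟩ := TopologicalSpace.exists_countable_basis X
  -- The zero function serves the pairs that no function separates, so one function can be chosen
  -- for every pair.
  have hex (p : Set X × Set X) : ∃ f : X → ℝ, Continuous f ∧ HasCompactSupport f ∧
      ((∃ f : X → ℝ, Continuous f ∧ HasCompactSupport f ∧ EqOn f 1 p.1 ∧ EqOn f 0 p.2ᶜ) →
        EqOn f 1 p.1 ∧ EqOn f 0 p.2ᶜ) := by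
    by_cases h : ∃ f : X → ℝ, Continuous f ∧ HasCompactSupport f ∧ EqOn f 1 p.1 ∧ EqOn f 0 p.2ᶜ
    · obtain ⟨f, hf, hfc, hf'⟩ := h
      exact ⟨f, hf, hfc, fun _ => hf'⟩
    · exact ⟨0, continuous_zero, HasCompactSupport.zero, fun h' => absurd h' h⟩
  choose F hF hFc hF' using hex
  -- The extra pair makes the index set nonempty, hence enumerable by `ℕ`, even if the basis is
  -- empty.
  obtain ⟨b, hb⟩ := ((hBc.prod hBc).insert (∅, ∅)).exists_eq_range (insert_nonempty _ _)
  refine ⟨fun n => F (b n), fun n => hF _, fun n => hFc _, fun x U hU => ?_⟩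
  obtain ⟨V, hVB, hxV, hVU⟩ := hB.mem_nhds_iff.1 hU
  -- With `x ∈ V' ⊆ K ⊆ V`, a Urysohn function for `K` inside `V` shows that the basic pair `(V',
  -- V)` is separable.
  obtain ⟨K, hKx, hKV, hK⟩ := local_compact_nhds ((hB.isOpen hVB).mem_nhds hxV)
  obtain ⟨V', hVB', hxV', hVK'⟩ := hB.mem_nhds_iff.1 hKx
  obtain ⟨f, hf₁, hf₀, hfc, -⟩ := exists_continuous_one_zero_of_isCompact hK
    (hB.isOpen hVB).isClosed_compl (disjoint_compl_right_iff_subset.2 hKV)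
  obtain ⟨n, hn⟩ : (V', V) ∈ range b := hb ▸ mem_insert_of_mem _ ⟨hVB', hVB⟩
  obtain ⟨h₁, h₀⟩ := hF' (V', V) ⟨f, f.continuous, hfc, hf₁.mono hVK', hf₀⟩
  refine ⟨n, ?_, fun y hy => ?_⟩
  · simp only [hn]
    exact h₁ hxV'
  · simp only [hn]
    exact h₀ fun hyV => hy (hVU hyV)

end AlgGroupoid

theorem mainTheorem2 {G : Type*} [AlgGroupoid G] (τ : TopologicalSpace G)
    (hgpd : @AlgGroupoid.IsTopologicalGroupoid G _ τ)
    (htrans : AlgGroupoid.IsTransitive G)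
    (hsc : @SecondCountableTopology G τ)
    (hlc : @LocallyCompactSpace G τ)
    (hT2 : @T2Space G τ) :
    ∃ τ' : TopologicalSpace G,
      (∃ 𝒲 : AlgGroupoid.GUniformity G, 𝒲.sets.Countable ∧
        @AlgGroupoid.GUniformity.CompatibleWithRFibres G _ τ 𝒲 ∧ τ' = 𝒲.topology) ∧
      -- locally transitive topological groupoid, with open range map
      (@AlgGroupoid.IsTopologicalGroupoid G _ τ' ∧
        @AlgGroupoid.IsLocallyTransitive G _ τ' ∧
        @IsOpenMap G (AlgGroupoid.units G) τ' (@instTopologicalSpaceSubtype G _ τ')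
          AlgGroupoid.rangeMap) ∧
      -- `τ'` is finer than `τ`, with equality if `τ` is locally transitive
      (τ' ≤ τ ∧ (@AlgGroupoid.IsLocallyTransitive G _ τ → τ' = τ)) ∧
      -- the induced topologies on the fibres coincide
      (∀ u ∈ AlgGroupoid.units G,
        TopologicalSpace.induced (Subtype.val : AlgGroupoid.rFibre u → G) τ' =
          TopologicalSpace.induced (Subtype.val : AlgGroupoid.rFibre u → G) τ ∧
        TopologicalSpace.induced (Subtype.val : AlgGroupoid.dFibre u → G) τ' =
          TopologicalSpace.induced (Subtype.val : AlgGroupoid.dFibre u → G) τ) ∧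
      (@SecondCountableTopology G τ' ∧ @LocallyCompactSpace G τ' ∧ @T2Space G τ') ∧
      @borel G τ' = @borel G τ := by
  obtain ⟨f, hf, hfc, hsep⟩ := AlgGroupoid.exists_seq_hasCompactSupport G
  have h𝒲 := hgpd.isFibreBasis_uniformityOfSeq hf hfc hsep
  have hle := h𝒲.topology_le hgpd
  have hlc' := h𝒲.locallyCompactSpace hgpd htrans
  have hsc' := h𝒲.secondCountableTopology hgpd htrans
  refine ⟨_, ⟨AlgGroupoid.uniformityOfSeq f, countable_range _, h𝒲.compatibleWithRFibres, rfl⟩,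
    ⟨h𝒲.isTopologicalGroupoid hgpd, AlgGroupoid.GUniformity.isLocallyTransitive _,
      AlgGroupoid.GUniformity.isOpenMap_rangeMap _⟩,
    ⟨hle, fun hlt => le_antisymm hle
      (le_of_nhds_le_nhds (h𝒲.nhds_le_of_isLocallyTransitive hgpd hlt))⟩,
    fun u _ => ⟨h𝒲.induced_rFibre hgpd u, h𝒲.induced_dFibre hgpd u⟩,
    ⟨hsc', hlc', h𝒲.t2Space hgpd⟩,
    AlgGroupoid.borel_eq_borel_of_locallyCompact hle hT2 hlc' hsc'⟩
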